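/- A metric space $X$ has \emph{bounded geometry} if for every $R>0$ the closed balls of radius $R$ in $X$ are finite and have uniformly bounded cardinality (so $X$ is discrete). It has \emph{naive property A} if for all $R,\varepsilon>0$ there is a family $\{A_x\}_{x\in X}$ of finite non-empty subsets of $X$ such that (a) for all $x,y\in X$ with $d(x,y)\le R$, $A_x\cap A_y\neq\emptyset$ and $|A_x\triangle A_y|/|A_x\cap A_y|<\varepsilon$; and (b) there is $S>0$ such that $d(x,y)\le S$ for all $x\in X$ and $y\in A_x$. Metric spaces $X,Y$ are \emph{coarsely equivalent} if there are maps $f:X\to Y$, $g:Y\to X$ such that for every $R$ there is $S$ for which points at distance at most $R$ are sent by $f$, and likewise by $g$, to points at distance at most $S$, and such that $\sup_{x\in X} d(g(f(x)),x)<\infty$ and $\sup_{y\in Y} d(f(g(y)),y)<\infty$. Naive property A is preserved, for metric spaces of bounded geometry, under taking subspaces, finite unions, finite Cartesian products and coarse equivalences. That is: (1) if $X$ has bounded geometry and naive property A, then every subspace of $X$ has naive property A; (2) if $U_1,\dots,U_n$ are subspaces of a metric space, each of bounded geometry and with naive property A, then $U_1\cup\dots\cup U_n$ has naive property A; (3)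 if $X_1,\dots,X_n$ are metric spaces of bounded geometry with naive property A, then for each $p\in[1,\infty]$ the product $X_1\times\dots\times X_n$ with the $\ell^p$-product metric (the sup metric for $p=\infty$) has naive property A; (4) if $X$ and $Y$ are coarsely equivalent metric spaces of bounded geometry, then $X$ has naive property A if and only if $Y$ does. -/

import Mathlib

universe u v w

/-- A metric space has bounded geometry if for every `R > 0` the closed balls of radius `R` are
finite, with a uniform bound on their cardinalities. (Such a space is in particular discrete:
all balls are finite.) -/
def BoundedGeometry (X : Type*) [MetricSpace X] : Prop :=
  ∀ R : ℝ, 0 < R → ∃ N : ℕ, ∀ x : X, (Metric.closedBall x R).encard ≤ N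

open scoped Classical in
/-- Naive property A: for all `R, ε > 0` there is a family of finite non-empty subsets
`A x ⊆ X` such that `|A x ∆ A y| / |A x ∩ A y| < ε` whenever `d(x, y) ≤ R`, and such that the
`A x` are uniformly bounded around `x`. The quotient presupposes `A x ∩ A y ≠ ∅`; this is stated
explicitly because of the convention `a / 0 = 0`. -/
def NaivePropertyA (X : Type*) [MetricSpace X] : Prop :=
  ∀ R ε : ℝ, 0 < R → 0 < ε → ∃ A : X → Finset X,
    (∀ x, (A x).Nonempty) ∧
    (∀ x y, dist x y ≤ R → (A x ∩ A y).Nonempty ∧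
      ((symmDiff (A x) (A y)).card : ℝ) / ((A x ∩ A y).card : ℝ) < ε) ∧
    (∃ S : ℝ, 0 < S ∧ ∀ x, ∀ y ∈ A x, dist x y ≤ S)

/-- A map is bornologous if it expands distances in a uniformly controlled way. -/
def Bornologous {X Y : Type*} [MetricSpace X] [MetricSpace Y] (f : X → Y) : Prop :=
  ∀ R : ℝ, ∃ S : ℝ, ∀ x x' : X, dist x x' ≤ R → dist (f x) (f x') ≤ S

/-- Two maps into a metric space are close if they are at bounded distance. -/
def CloseMaps {X Y : Type*} [MetricSpace Y] (f g : X → Y) : Prop :=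
  ∃ C : ℝ, ∀ x : X, dist (f x) (g x) ≤ C

/-- `X` and `Y` are coarsely equivalent: there are bornologous maps `f : X → Y` and `g : Y → X`
whose two composites are close to the identity maps. (The maps `f` and `g` are then automatically
proper, so they are coarse maps.) -/
def CoarselyEquivalent (X Y : Type*) [MetricSpace X] [MetricSpace Y] : Prop :=
  ∃ (f : X → Y) (g : Y → X), Bornologous f ∧ Bornologous g ∧
    CloseMaps (g ∘ f) id ∧ CloseMaps (f ∘ g) id

/-!
The proof passes through an intermediate property of a metric space `X`, fractional hyperfiniteness:
for all `R` and `ε > 0` there are finitely many partitions of `X` into uniformly bounded parts such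
that any two points at distance at most `R` are separated by less than a proportion `ε` of them. For
spaces of bounded geometry it is equivalent to naive property A, and its permanence properties are
direct.

From naive property A (`NaivePropertyA.fractionallyHyperfinite`): order the colours of a suitable
finite colouring of `X` at random and send `x` to the first point of `A x`. The points `x` and `y` get
different images with probability at most `|A x ∆ A y| / |A x ∪ A y|`, and the fibres are bounded.
Bounded geometry provides the finite colouring, hence a finite probability space.

To naive property A (`FractionallyHyperfinite.naivePropertyA`): the difficulty is that the sets `A x`
carry no multiplicities. The number `n` of partitions is known before the sets have to be chosen, so
it is enough to have `n` distinct points, one token per partition, in each ball of some fixed radius.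
Where the chain components at scale `R` have diameter exceeding a suitable multiple of `n * R` there is
such room, and `A x` consists of one nearby token for each partition, determined by the part containing
`x`; elsewhere `A x` is the whole component. This is what makes subspaces work, as a subspace need not
contain the sets of the ambient space.

Fractional hyperfiniteness pulls back along coarse embeddings, which gives subspaces and coarse
equivalences; products of partitions give finite products; and for `U ∪ V` a random distance threshold
from `U` decides which points follow a partition of `U` and which one of `V`.
-/

open scoped Finset

/-! ### Fractional hyperfiniteness -/

/-- A finite family of partitions of `X`, encoded as equivalence relations, whose parts have uniformly
bounded diameter, and such that any two points at distance at most `R` are separated by a proportion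
of less than `ε` of the partitions. -/
def BoundedlySparse {X : Type*} [MetricSpace X] {I : Type*} [Fintype I] (R ε : ℝ)
    (P : I → Setoid X) : Prop :=
  (∃ S : ℝ, ∀ i x y, P i x y → dist x y ≤ S) ∧
    ∀ x y, dist x y ≤ R → (Nat.card {i // ¬ P i x y} : ℝ) < ε * Fintype.card I

/-- At all scales `R` and for all `ε`, a nonempty finite family of partitions into uniformly bounded
parts of which only a proportion less than `ε` separates any given two points at distance at most
`R`. The families are indexed by `Fin n` so that no universe is quantified over. -/
def FractionallyHyperfinite (X : Type*) [MetricSpace X] : Prop :=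
  ∀ R ε : ℝ, 0 < ε → ∃ (n : ℕ) (P : Fin n → Setoid X), 0 < n ∧ BoundedlySparse R ε P

theorem BoundedlySparse.comp_equiv {X : Type*} [MetricSpace X] {I J : Type*} [Fintype I]
    [Fintype J] {R ε : ℝ} {P : I → Setoid X} (h : BoundedlySparse R ε P) (e : J ≃ I) :
    BoundedlySparse R ε (P ∘ e) := by
  obtain ⟨⟨S, hS⟩, h⟩ := h
  refine ⟨⟨S, fun i x y hxy => hS _ x y hxy⟩, fun x y hxy => ?_⟩
  have h1 : Nat.card {i // ¬ (P ∘ e) i x y} = Nat.card {i // ¬ P i x y} :=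
    Nat.card_congr (e.subtypeEquiv fun _ => Iff.rfl)
  rw [h1, Fintype.card_congr e]
  exact h x y hxy

theorem FractionallyHyperfinite.of_finite_families {X : Type*} [MetricSpace X]
    (h : ∀ R ε : ℝ, 0 < ε → ∃ (I : Type v) (_ : Fintype I) (_ : Nonempty I) (P : I → Setoid X),
      BoundedlySparse R ε P) : FractionallyHyperfinite X := by
  intro R ε hε
  obtain ⟨I, _, _, P, hP⟩ := h R ε hε
  exact ⟨Fintype.card I, _, Fintype.card_pos, hP.comp_equiv (Fintype.equivFin I).symm⟩

/-! ### From naive property A to fractional hyperfiniteness -/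

/-- Greedy colouring along a well-order of `X`: each point avoids the colours of the earlier points
within distance `T`, of which there are boundedly many. -/
theorem BoundedGeometry.exists_coloring {X : Type*} [MetricSpace X] (hX : BoundedGeometry X)
    {T : ℝ} (hT : 0 < T) :
    ∃ (K : ℕ) (c : X → Fin K), ∀ x y, dist x y ≤ T → c x = c y → x = y := by
  obtain ⟨N, hN⟩ := hX T hT
  have wf : WellFounded (WellOrderingRel (α := X)) := IsWellFounded.wf
  let F : ∀ x : X, (∀ y, WellOrderingRel y x → Fin (N + 1)) → Fin (N + 1) := fun x ih =>
    Classical.epsilon fun k => ∀ y (hy : WellOrderingRel y x), dist x y ≤ T → ih y hy ≠ k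
  let c : X → Fin (N + 1) := wf.fix F
  have hc : ∀ x y, WellOrderingRel y x → dist x y ≤ T → c y ≠ c x := by
    intro x
    have hx : c x = F x fun y _ => c y := wf.fix_eq F x
    have hex : ∃ k, ∀ y, WellOrderingRel y x → dist x y ≤ T → c y ≠ k := by
      by_contra! hcon
      have hsub : (Set.univ : Set (Fin (N + 1))) ⊆ c '' Metric.closedBall x T := by
        intro k _
        obtain ⟨y, -, hy, hk⟩ := hcon k
        exact ⟨y, by rwa [Metric.mem_closedBall, dist_comm], hk⟩
      have h1 := (Set.encard_le_encard hsub).trans ((Set.encard_image_le _ _).trans (hN x))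
      rw [Set.encard_univ, ENat.card_eq_coe_fintype_card, Fintype.card_fin] at h1
      have : N + 1 ≤ N := by exact_mod_cast h1
      omega
    have := Classical.epsilon_spec hex
    rw [hx]
    exact this
  refine ⟨N + 1, c, fun x y hxy hcxy => ?_⟩
  rcases trichotomous_of (WellOrderingRel (α := X)) x y with h | h | h
  · exact absurd hcxy (hc y x h (by rwa [dist_comm]))
  · exact h
  · exact absurd hcxy.symm (hc x y h hxy)

/-- Under a random permutation, each element of `T` is equally likely to become the smallest. -/
theorem exists_card_perm_minimizing {α : Type*} [Fintype α] [LinearOrder α] {T : Finset α}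
    (hT : T.Nonempty) :
    ∃ q : ℕ, (∀ t ∈ T, #{σ : Equiv.Perm α | ∀ s ∈ T, σ t ≤ σ s} = q) ∧
      q * #T = Fintype.card (Equiv.Perm α) := by
  obtain ⟨t₀, ht₀⟩ := hT
  let E : α → Finset (Equiv.Perm α) := fun t => {σ | ∀ s ∈ T, σ t ≤ σ s}
  -- Composing with the transposition of `t` and `t'` turns minimality of `t` into that of `t'`.
  have hle : ∀ t ∈ T, ∀ t' ∈ T, #(E t) ≤ #(E t') := by
    intro t ht t' ht'
    refine Finset.card_le_card_of_injOn (fun σ => σ * Equiv.swap t t') ?_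
      (fun σ _ τ _ h => mul_right_cancel h)
    intro σ hσ
    simp only [E, Finset.coe_filter, Finset.mem_univ, true_and, Set.mem_ofPred_eq,
      Equiv.Perm.mul_apply, Equiv.swap_apply_right] at hσ ⊢
    intro s hs
    refine hσ _ ?_
    rcases eq_or_ne s t with rfl | h1
    · rwa [Equiv.swap_apply_left]
    rcases eq_or_ne s t' with rfl | h2
    · rwa [Equiv.swap_apply_right]
    rwa [Equiv.swap_apply_of_ne_of_ne h1 h2]
  have heq : ∀ t ∈ T, #(E t) = #(E t₀) := fun t ht =>
    le_antisymm (hle t ht t₀ ht₀) (hle t₀ ht₀ t ht)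
  refine ⟨#(E t₀), heq, ?_⟩
  have hU : T.biUnion E = Finset.univ := by
    refine Finset.eq_univ_of_forall fun σ => ?_
    obtain ⟨t, ht, hmin⟩ := T.exists_min_image σ ⟨t₀, ht₀⟩
    exact Finset.mem_biUnion.2 ⟨t, ht, by simpa [E] using hmin⟩
  have hdisj : (T : Set α).PairwiseDisjoint E := by
    intro t ht t' ht' hne
    refine Finset.disjoint_left.2 fun σ h h' => hne ?_
    simp only [E, Finset.mem_filter, Finset.mem_univ, true_and] at h h'
    exact σ.injective (le_antisymm (h t' ht') (h' t ht))
  rw [← Finset.card_univ, ← hU, Finset.card_biUnion hdisj, Finset.sum_congr rfl heq,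
    Finset.sum_const, smul_eq_mul, mul_comm]

open scoped Classical in
/-- Under a random order, the minimizers over `A` and over `B` differ with probability at most
`|A ∆ B| / |A ∪ B|`: if the minimizer over `A ∪ B` lies in `A ∩ B`, it is the minimizer over both. -/
theorem card_perm_argmin_ne_mul_le {X α : Type*} [Fintype α] [LinearOrder α] {c : X → α}
    {A B : Finset X} (hinj : Set.InjOn c (A ∪ B : Finset X)) (hAB : (A ∪ B).Nonempty)
    {a b : Equiv.Perm α → X}
    (ha : ∀ σ, a σ ∈ A ∧ ∀ w ∈ A, σ (c (a σ)) ≤ σ (c w))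
    (hb : ∀ σ, b σ ∈ B ∧ ∀ w ∈ B, σ (c (b σ)) ≤ σ (c w)) :
    Nat.card {σ // ¬ a σ = b σ} * #(A ∪ B) ≤
      #(symmDiff A B) * Fintype.card (Equiv.Perm α) := by
  obtain ⟨q, hq, hqT⟩ := exists_card_perm_minimizing (hAB.image c)
  rw [Finset.card_image_of_injOn hinj] at hqT
  have hsub : (Finset.univ.filter fun σ => ¬ a σ = b σ) ⊆ ((symmDiff A B).image c).biUnion
      fun t => {σ : Equiv.Perm α | ∀ s ∈ (A ∪ B).image c, σ t ≤ σ s} := by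
    intro σ hσ
    rw [Finset.mem_filter] at hσ
    obtain ⟨v, hv, hmin⟩ := (A ∪ B).exists_min_image (fun w => σ (c w)) hAB
    -- A minimizer over the union that lies in both sets is the minimizer over each of them.
    have key : ∀ w ∈ A ∪ B, σ (c w) ≤ σ (c v) → w = v := fun w hw hle =>
      hinj hw hv (σ.injective (le_antisymm hle (hmin w hw)))
    have hvS : v ∈ symmDiff A B := by
      by_contra hcon
      have hv2 : v ∈ A ∧ v ∈ B := by
        rw [Finset.mem_symmDiff] at hcon
        rw [Finset.mem_union] at hv
        tauto
      refine hσ.2 ((key _ (Finset.mem_union_left _ (ha σ).1) ((ha σ).2 v hv2.1)).trans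
        (key _ (Finset.mem_union_right _ (hb σ).1) ((hb σ).2 v hv2.2)).symm)
    refine Finset.mem_biUnion.2 ⟨c v, Finset.mem_image_of_mem _ hvS, ?_⟩
    simpa using fun w hw => hmin w (by simpa using hw)
  have hcard : Nat.card {σ // ¬ a σ = b σ} ≤ #(symmDiff A B) * q := by
    rw [Nat.card_eq_fintype_card, Fintype.card_subtype]
    refine (Finset.card_le_card hsub).trans
      ((Finset.card_biUnion_le_card_mul _ _ q fun t ht => ?_).trans
        (Nat.mul_le_mul_right _ Finset.card_image_le))
    refine (hq t (Finset.image_subset_image ?_ ht)).le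
    intro w hw
    rw [Finset.mem_symmDiff] at hw
    rw [Finset.mem_union]
    tauto
  calc _ ≤ #(symmDiff A B) * q * #(A ∪ B) := Nat.mul_le_mul_right _ hcard
    _ = _ := by rw [mul_assoc, hqT]

/-- Colour `X` so that points in `A x ∪ A y` have distinct colours whenever `x` and `y` are close. For
each permutation `σ` of the colours, `x` is assigned to the point of `A x` whose colour comes first
under `σ`, and the fibres of this assignment form a partition. -/
theorem NaivePropertyA.fractionallyHyperfinite {X : Type*} [MetricSpace X]
    (hA : NaivePropertyA X) (hX : BoundedGeometry X) : FractionallyHyperfinite X := by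
  classical
  refine FractionallyHyperfinite.of_finite_families fun R ε hε => ?_
  -- Naive property A only speaks about positive scales, and `R` is arbitrary.
  obtain ⟨A, hne, hAB, S, hS, hAS⟩ := hA (max R 1) ε (by positivity) hε
  obtain ⟨K, c, hc⟩ := hX.exists_coloring (T := 2 * S + max R 1) (by positivity)
  choose φ hφmem hφmin using fun (σ : Equiv.Perm (Fin K)) x =>
    (A x).exists_min_image (fun w => σ (c w)) (hne x)
  refine ⟨Equiv.Perm (Fin K), inferInstance, inferInstance, fun σ => Setoid.ker (φ σ),
    ⟨2 * S, fun σ x y hxy => ?_⟩, fun x y hxy => ?_⟩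
  · have h1 := hAS x _ (hφmem σ x)
    have h2 := hAS y _ (hφmem σ y)
    rw [← Setoid.ker_def.1 hxy] at h2
    linarith [dist_triangle_right x y (φ σ x)]
  · have hxy' : dist x y ≤ max R 1 := hxy.trans (le_max_left _ _)
    obtain ⟨hne', hlt⟩ := hAB x y hxy'
    have hR : 0 < max R 1 := by positivity
    have hinj : Set.InjOn c (A x ∪ A y : Finset X) := by
      intro w hw w' hw' h
      refine hc w w' ?_ h
      rw [Finset.mem_coe, Finset.mem_union] at hw hw'
      have h1 := dist_triangle_left w w' x
      have h2 := dist_triangle_left w w' y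
      have h3 := dist_triangle x y w
      have h4 := dist_triangle x y w'
      rcases hw with hw | hw <;> rcases hw' with hw' | hw' <;>
        linarith [hAS _ _ hw, hAS _ _ hw']
    have hcount := card_perm_argmin_ne_mul_le hinj ((hne x).mono Finset.subset_union_left)
      (a := fun σ => φ σ x) (b := fun σ => φ σ y)
      (fun σ => ⟨hφmem σ x, hφmin σ x⟩) (fun σ => ⟨hφmem σ y, hφmin σ y⟩)
    have hc0 : (0 : ℝ) < #(A x ∩ A y) := by exact_mod_cast hne'.card_pos
    have hcu : (#(A x ∩ A y) : ℝ) ≤ #(A x ∪ A y) := by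
      exact_mod_cast Finset.card_le_card
        (Finset.inter_subset_left.trans Finset.subset_union_left)
    have hK : (0 : ℝ) < Fintype.card (Equiv.Perm (Fin K)) := by
      exact_mod_cast Fintype.card_pos
    rw [div_lt_iff₀ hc0] at hlt
    have hcount' : (Nat.card {σ // ¬ φ σ x = φ σ y} : ℝ) * #(A x ∪ A y) ≤
        #(symmDiff (A x) (A y)) * Fintype.card (Equiv.Perm (Fin K)) := by exact_mod_cast hcount
    refine lt_of_mul_lt_mul_right (a := (#(A x ∪ A y) : ℝ)) ?_ (Nat.cast_nonneg _)
    calc _ ≤ _ := hcount'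
      _ < ε * #(A x ∩ A y) * Fintype.card (Equiv.Perm (Fin K)) := by
        convert mul_lt_mul_of_pos_right hlt hK
      _ ≤ ε * #(A x ∪ A y) * Fintype.card (Equiv.Perm (Fin K)) := by gcongr
      _ = _ := by ring

/-! ### From fractional hyperfiniteness to naive property A -/

/-- A chain with steps of length at most `R` cannot jump over an annulus of width `R`. -/
theorem exists_dist_mem_Ioc_of_reflTransGen {X : Type*} [MetricSpace X] {R t : ℝ} {x y : X}
    (h : Relation.ReflTransGen (fun a b => dist a b ≤ R) x y) (ht : 0 ≤ t) (hy : t < dist x y) :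
    ∃ z, dist x z ∈ Set.Ioc (t - R) t := by
  induction h with
  | refl => rw [dist_self] at hy; linarith
  | @tail b c _ hbc ih =>
    rcases lt_or_ge t (dist x b) with hb | hb
    · exact ih hb
    · exact ⟨b, by linarith [dist_triangle x b c], hb⟩

theorem exists_injective_dist_le_of_reflTransGen {X : Type*} [MetricSpace X] {R : ℝ} {n : ℕ}
    (hR : 0 < R) {x y : X} (h : Relation.ReflTransGen (fun a b => dist a b ≤ R) x y)
    (hy : n * R < dist x y) :
    ∃ f : Fin n → X, Function.Injective f ∧ ∀ i, dist x (f i) ≤ n * R := by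
  have hlt : ∀ i : Fin n, ((i : ℕ) : ℝ) * R ≤ n * R := fun i => by
    have : ((i : ℕ) : ℝ) ≤ n := by exact_mod_cast i.2.le
    gcongr
  choose f hf using fun i : Fin n => exists_dist_mem_Ioc_of_reflTransGen h
    (t := ((i : ℕ) : ℝ) * R) (by positivity) ((hlt i).trans_lt hy)
  -- The `i`-th point lies in the annulus of radii `(i - 1) * R` and `i * R`.
  have hle : ∀ i j, f i = f j → i ≤ j := by
    intro i j hij
    have h1 := (hf i).1
    rw [hij] at h1
    have h2 : (((i : ℕ) : ℝ) - 1) * R < ((j : ℕ) : ℝ) * R := by linarith [(hf j).2]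
    have h3 : ((i : ℕ) : ℝ) < ((j : ℕ) : ℝ) + 1 := by linarith [lt_of_mul_lt_mul_right h2 hR.le]
    have h4 : (i : ℕ) < (j : ℕ) + 1 := by exact_mod_cast h3
    exact Fin.le_def.2 (by omega)
  exact ⟨f, fun i j hij => le_antisymm (hle i j hij) (hle j i hij.symm),
    fun i => (hf i).2.trans (hlt i)⟩

/-- If every ball of radius `D` around a point of `B` holds `n` points, then one can attach to each
point of `B` a nearby token of each colour `i : Fin n` in such a way that tokens of different colours
never coincide, even for different points. Take a maximal `2 * D`-separated set of centres in `B`: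
the `D`-balls around them are disjoint and each holds one token of each colour, and every point of
`B` borrows the tokens of a centre within distance `2 * D`. -/
theorem exists_bounded_token_map {X : Type*} [MetricSpace X] {n : ℕ} {D : ℝ} (B : Set X)
    (hB : ∀ x ∈ B, ∃ f : Fin n → X, Function.Injective f ∧ ∀ i, dist x (f i) ≤ D) :
    ∃ τ : B → Fin n → X, (∀ (x : B) i, dist (x : X) (τ x i) ≤ 3 * D) ∧
      ∀ x y i j, τ x i = τ y j → i = j := by
  obtain ⟨Z, hZ⟩ := zorn_subset {Z : Set B | Z.Pairwise fun x y => 2 * D < dist x y} (by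
    intro c hc hchain
    exact ⟨⋃₀ c, (Set.pairwise_sUnion hchain.directedOn).2 fun s hs => hc hs,
      fun s hs => Set.subset_sUnion_of_mem hs⟩)
  choose! f hinj hdist using hB
  have hcover : ∀ x : B, ∃ z ∈ Z, z = x ∨ dist (x : X) z ≤ 2 * D := by
    intro x
    by_contra! hcon
    have hmem : insert x Z ∈ {Z : Set B | Z.Pairwise fun x y => 2 * D < dist x y} :=
      hZ.1.insert fun z hz _ => ⟨(hcon z hz).2, by rw [dist_comm]; exact (hcon z hz).2⟩
    exact (hcon x (hZ.2 hmem (Set.subset_insert x Z) (Set.mem_insert x Z))).1 rfl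
  choose ζ hζ hζd using hcover
  refine ⟨fun x => f (ζ x), fun x i => ?_, fun x y i j h => ?_⟩
  · have h1 := hdist _ (ζ x).2 i
    have h2 := dist_triangle (x : X) (ζ x) (f (ζ x) i)
    have h0 : 0 ≤ D := dist_nonneg.trans h1
    dsimp only
    rcases hζd x with h | h
    · rw [h] at h1 ⊢
      linarith
    · linarith
  · have hz : ζ x = ζ y := by
      by_contra hne
      have h1 : 2 * D < dist (ζ x : X) (ζ y) := hZ.1 (hζ x) (hζ y) hne
      have h2 := hdist _ (ζ x).2 i
      have h3 := hdist _ (ζ y).2 j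
      dsimp only at h
      rw [← h] at h3
      linarith [dist_triangle_right (ζ x : X) (ζ y) (f (ζ x) i)]
    dsimp only at h
    rw [hz] at h
    exact hinj _ (ζ y).2 h

open scoped Classical in
theorem card_symmDiff_div_card_inter_lt {X : Type*} {A B : Finset X} {n : ℕ} {ε : ℝ}
    (hε : 0 < ε) (hA : #A = n) (hB : #B = n) (h : 2 / (2 + ε) * n < #(A ∩ B)) :
    (#(symmDiff A B) : ℝ) / #(A ∩ B) < ε := by
  have hc : (0 : ℝ) < #(A ∩ B) := lt_of_le_of_lt (by positivity) h
  have h1 : #(symmDiff A B) + 2 * #(A ∩ B) = 2 * n := by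
    have h2 : #(symmDiff A B) = #(A \ B) + #(B \ A) :=
      Finset.card_union_of_disjoint disjoint_sdiff_sdiff
    have h3 := Finset.card_sdiff_add_card_inter A B
    have h4 := Finset.card_sdiff_add_card_inter B A
    rw [Finset.inter_comm] at h4
    omega
  have h5 : (#(symmDiff A B) : ℝ) + 2 * #(A ∩ B) = 2 * n := by exact_mod_cast h1
  rw [div_lt_iff₀ hc]
  rw [div_mul_eq_mul_div, div_lt_iff₀ (by positivity)] at h
  linarith

/-- Among points whose `R`-chain component has bounded diameter, `A x` is that component. Any other
point sees at least `n` points in the ball of radius `n * R`, where `n` is the number of partitions.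
There `A x` consists of the tokens of colour `i` attached to the chosen representative of the part
of `x` in the `i`-th partition, for all `i`: it has exactly `n` elements, and `A x` and `A y` share
the `i`-th one whenever the `i`-th partition does not separate `x` and `y`. -/
theorem FractionallyHyperfinite.naivePropertyA {X : Type*} [MetricSpace X]
    (hF : FractionallyHyperfinite X) (hX : BoundedGeometry X) : NaivePropertyA X := by
  classical
  intro R ε hR hε
  -- If a proportion of more than `2 / (2 + ε)` of the partitions keeps `x` and `y` together, then the
  -- quotient in question is less than `ε`.
  obtain ⟨n, P, hn, ⟨S, hS⟩, hP⟩ := hF R (ε / (2 + ε)) (by positivity)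
  have hn' : (0 : ℝ) < n := by exact_mod_cast hn
  -- `C x` is the `R`-chain component of `x`; `B` is the union of the components of large diameter.
  let C : X → Set X := fun x => {y | Relation.ReflTransGen (fun a b => dist a b ≤ R) x y}
  have hCself : ∀ x, x ∈ C x := fun x => Relation.ReflTransGen.refl
  have hCle : ∀ x y, dist x y ≤ R → C y ⊆ C x := fun x y hxy z hz =>
    Relation.ReflTransGen.head hxy hz
  have hCeq : ∀ x y, dist x y ≤ R → C x = C y := fun x y hxy =>
    (hCle y x (by rwa [dist_comm])).antisymm (hCle x y hxy)
  let B : Set X := {x | ∃ y ∈ C x, ∃ z ∈ C x, 2 * (n * R) < dist y z}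
  have hBiff : ∀ x y, dist x y ≤ R → (x ∈ B ↔ y ∈ B) := fun x y hxy => by
    simp only [B, Set.mem_ofPred_eq, hCeq x y hxy]
  have hB : ∀ x ∈ B, ∃ f : Fin n → X, Function.Injective f ∧ ∀ i, dist x (f i) ≤ n * R := by
    rintro x ⟨y, hy, z, hz, hyz⟩
    have := dist_triangle_left y z x
    rcases lt_or_ge (n * R) (dist x y) with h | h
    · exact exists_injective_dist_le_of_reflTransGen hR hy h
    · exact exists_injective_dist_le_of_reflTransGen hR hz (by linarith)
  have hsmall : ∀ x, x ∉ B → C x ⊆ Metric.closedBall x (2 * (n * R)) := by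
    intro x hx y hy
    by_contra hcon
    rw [Metric.mem_closedBall, not_le] at hcon
    exact hx ⟨y, hy, x, hCself x, hcon⟩
  obtain ⟨τ, hτ, hτinj⟩ := exists_bounded_token_map B hB
  have hfin : ∀ x, (C x ∩ Metric.closedBall x (2 * (n * R))).Finite := by
    intro x
    obtain ⟨N, hN⟩ := hX (2 * (n * R)) (by positivity)
    exact (Set.finite_of_encard_le_coe (hN x)).subset Set.inter_subset_right
  -- `t i x` is the chosen representative, inside `B`, of the part of `x` in the `i`-th partition.
  let t : Fin n → B → B := fun i x => (Quotient.mk ((P i).comap Subtype.val) x).out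
  have htP : ∀ i x, P i (t i x) x := fun i x => @Quotient.mk_out _ ((P i).comap Subtype.val) x
  have hteq : ∀ i (x y : B), P i x y → t i x = t i y := fun i x y h =>
    congrArg Quotient.out (@Quotient.sound _ ((P i).comap Subtype.val) x y h)
  let A : X → Finset X := fun x =>
    if h : x ∈ B then Finset.univ.image fun i => τ (t i ⟨x, h⟩) i else (hfin x).toFinset
  have hAB : ∀ x (h : x ∈ B), A x = Finset.univ.image fun i => τ (t i ⟨x, h⟩) i :=
    fun x h => dif_pos h
  have hAnB : ∀ x, x ∉ B → A x = (hfin x).toFinset := fun x h => dif_neg h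
  have hAne : ∀ x, (A x).Nonempty := by
    intro x
    by_cases hx : x ∈ B
    · rw [hAB x hx]
      exact ⟨_, Finset.mem_image_of_mem _ (Finset.mem_univ (⟨0, hn⟩ : Fin n))⟩
    · rw [hAnB x hx]
      exact ⟨x, by simpa using ⟨hCself x, by positivity⟩⟩
  refine ⟨A, hAne, fun x y hxy => ?_, 2 * (n * R) + |S| + 3 * (n * R), by positivity, ?_⟩
  · by_cases hx : x ∈ B
    · have hy := (hBiff x y hxy).1 hx
      have hcard : ∀ z (hz : z ∈ B), #(A z) = n := by
        intro z hz
        rw [hAB z hz, Finset.card_image_of_injective _ fun i j h => hτinj _ _ i j h,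
          Finset.card_univ, Fintype.card_fin]
      have hgood : #{i | P i x y} ≤ #(A x ∩ A y) := by
        refine Finset.card_le_card_of_injOn (fun i => τ (t i ⟨x, hx⟩) i) ?_
          (fun i _ j _ h => hτinj _ _ i j h)
        intro i hi
        rw [Finset.mem_coe, Finset.mem_filter] at hi
        rw [Finset.mem_coe, Finset.mem_inter, hAB x hx, hAB y hy]
        refine ⟨Finset.mem_image_of_mem _ (Finset.mem_univ i), ?_⟩
        dsimp only
        rw [hteq i ⟨x, hx⟩ ⟨y, hy⟩ hi.2]
        exact Finset.mem_image_of_mem (fun i => τ (t i ⟨y, hy⟩) i) (Finset.mem_univ i)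
      have hlt : 2 / (2 + ε) * n < #(A x ∩ A y) := by
        have h1 := hP x y hxy
        rw [Nat.card_eq_fintype_card, Fintype.card_subtype, Fintype.card_fin] at h1
        have h2 : #{i | P i x y} + #{i | ¬ P i x y} = n := by
          rw [Finset.card_filter_add_card_filter_not, Finset.card_univ, Fintype.card_fin]
        have h3 : (#{i | P i x y} : ℝ) + #{i | ¬ P i x y} = n := by exact_mod_cast h2
        have h4 : (#{i | P i x y} : ℝ) ≤ #(A x ∩ A y) := by exact_mod_cast hgood
        have h5 : 2 / (2 + ε) * n + ε / (2 + ε) * n = n := by field_simp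
        linarith
      refine ⟨Finset.card_pos.1 ?_,
        card_symmDiff_div_card_inter_lt hε (hcard x hx) (hcard y hy) hlt⟩
      have : (0 : ℝ) < #(A x ∩ A y) := lt_of_le_of_lt (by positivity) hlt
      exact_mod_cast this
    · have hy : y ∉ B := fun h => hx ((hBiff x y hxy).2 h)
      have heq : A x = A y := by
        rw [hAnB x hx, hAnB y hy, Set.Finite.toFinset_inj,
          Set.inter_eq_left.2 (hsmall x hx), Set.inter_eq_left.2 (hsmall y hy), hCeq x y hxy]
      rw [heq, Finset.inter_self]
      exact ⟨hAne y, by simpa using hε⟩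
  · intro x y hy
    have hSabs := le_abs_self S
    by_cases hx : x ∈ B
    · rw [hAB x hx, Finset.mem_image] at hy
      obtain ⟨i, -, rfl⟩ := hy
      have h1 := hτ (t i ⟨x, hx⟩) i
      have h2 := hS i _ _ (htP i ⟨x, hx⟩)
      have h3 := dist_triangle_left x (τ (t i ⟨x, hx⟩) i) (t i ⟨x, hx⟩)
      have : 0 < n * R := by positivity
      linarith
    · rw [hAnB x hx, Set.Finite.mem_toFinset] at hy
      have h1 := hy.2
      rw [Metric.mem_closedBall, dist_comm] at h1
      have : 0 < n * R := by positivity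
      linarith [abs_nonneg S]

/-! ### Permanence of fractional hyperfiniteness -/

theorem FractionallyHyperfinite.comap {X Y : Type*} [MetricSpace X] [MetricSpace Y] {f : X → Y}
    (hY : FractionallyHyperfinite Y) (hf : Bornologous f)
    (hf' : ∀ S : ℝ, ∃ T : ℝ, ∀ x x', dist (f x) (f x') ≤ S → dist x x' ≤ T) :
    FractionallyHyperfinite X := by
  intro R ε hε
  obtain ⟨R', hR'⟩ := hf R
  obtain ⟨n, P, hn, ⟨S, hS⟩, hP⟩ := hY R' ε hε
  obtain ⟨T, hT⟩ := hf' S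
  exact ⟨n, fun i => (P i).comap f, hn, ⟨T, fun i x y h => hT x y (hS i _ _ h)⟩,
    fun x y hxy => hP _ _ (hR' x y hxy)⟩

/-- Pulling a condition on one coordinate back to the product of all index sets does not change the
proportion of indices that satisfy it. -/
theorem card_subtype_pi_apply_lt {ι : Type*} [Fintype ι] [DecidableEq ι] {I : ι → Type*}
    [∀ k, Fintype (I k)] [∀ k, Nonempty (I k)] {k : ι} {p : I k → Prop} {δ : ℝ}
    (h : (Nat.card {i // p i} : ℝ) < δ * Fintype.card (I k)) :
    (Nat.card {j : ∀ k, I k // p (j k)} : ℝ) < δ * Fintype.card (∀ k, I k) := by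
  have e : (∀ l, I l) ≃ I k × ∀ l : {l // l ≠ k}, I l := Equiv.piSplitAt k I
  have h1 : Nat.card {j : ∀ k, I k // p (j k)} =
      Nat.card {i // p i} * Fintype.card (∀ l : {l // l ≠ k}, I l) := by
    rw [← Nat.card_eq_fintype_card, ← Nat.card_prod]
    exact Nat.card_congr (((Equiv.piSplitAt k I).subtypeEquiv fun _ => Iff.rfl).trans
      Equiv.prodSubtypeFstEquivSubtypeProd)
  have h2 : Fintype.card (∀ k, I k) =
      Fintype.card (I k) * Fintype.card (∀ l : {l // l ≠ k}, I l) := by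
    rw [Fintype.card_congr e, Fintype.card_prod]
  have h3 : (0 : ℝ) < Fintype.card (∀ l : {l // l ≠ k}, I l) := by exact_mod_cast Fintype.card_pos
  rw [h1, h2, Nat.cast_mul, Nat.cast_mul, ← mul_assoc]
  exact mul_lt_mul_of_pos_right h h3

/-- The partitions of the product are products of partitions of the factors, so the proportion that
separates two points is at most the sum of the proportions in the factors. -/
theorem FractionallyHyperfinite.piLp {ι : Type v} [Fintype ι] {X : ι → Type u}
    [∀ i, MetricSpace (X i)] (p : ENNReal) [Fact (1 ≤ p)]
    (hX : ∀ i, FractionallyHyperfinite (X i)) : FractionallyHyperfinite (PiLp p X) := by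
  classical
  refine FractionallyHyperfinite.of_finite_families fun R ε hε => ?_
  choose n P hn hP using fun k => hX k R (ε / (Fintype.card ι + 1)) (by positivity)
  choose S hS using fun k => (hP k).1
  have : ∀ k, Nonempty (Fin (n k)) := fun k => ⟨⟨0, hn k⟩⟩
  let Q : (∀ k, Fin (n k)) → Setoid (PiLp p X) := fun j =>
    Setoid.ker fun x k => Quotient.mk (P k (j k)) (x k)
  have hQ : ∀ j x y, Q j x y ↔ ∀ k, P k (j k) (x k) (y k) := by
    intro j x y
    rw [Setoid.ker_def, funext_iff]
    exact forall_congr' fun k => Quotient.eq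
  have hbdd : ∀ j x y, Q j x y → dist (WithLp.ofLp x) (WithLp.ofLp y) ≤ ∑ k, |S k| := by
    intro j x y hxy
    refine (dist_pi_le_iff (Finset.sum_nonneg fun k _ => abs_nonneg _)).2 fun k => ?_
    exact (hS k _ _ _ ((hQ j x y).1 hxy k)).trans ((le_abs_self _).trans
      (Finset.single_le_sum (f := fun k => |S k|) (fun k _ => abs_nonneg _) (Finset.mem_univ k)))
  have hanti := (PiLp.antilipschitzWith_ofLp p X).le_mul_dist
  refine ⟨∀ k, Fin (n k), inferInstance, inferInstance, Q, ⟨_, fun j x y hxy => (hanti x y).trans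
    (mul_le_mul_of_nonneg_left (hbdd j x y hxy) (NNReal.coe_nonneg _))⟩, fun x y hxy => ?_⟩
  · have h1 : ∀ k, (Nat.card {j : ∀ k, Fin (n k) // ¬ P k (j k) (x k) (y k)} : ℝ) ≤
        ε / (Fintype.card ι + 1) * Fintype.card (∀ k, Fin (n k)) := fun k =>
      (card_subtype_pi_apply_lt (I := fun k => Fin (n k)) (p := fun i => ¬ P k i (x k) (y k))
        ((hP k).2 _ _ ((PiLp.dist_apply_le x y k).trans hxy))).le
    have h2 : Nat.card {j // ¬ Q j x y} ≤
        ∑ k, Nat.card {j : ∀ k, Fin (n k) // ¬ P k (j k) (x k) (y k)} := by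
      simp only [Nat.card_eq_fintype_card, Fintype.card_subtype]
      refine (Finset.card_le_card ?_).trans Finset.card_biUnion_le
      intro j hj
      rw [Finset.mem_filter, hQ, not_forall] at hj
      simpa using hj.2
    have hN : (0 : ℝ) < Fintype.card (∀ k, Fin (n k)) := by exact_mod_cast Fintype.card_pos
    calc (Nat.card {j // ¬ Q j x y} : ℝ)
        ≤ ∑ k, (Nat.card {j : ∀ k, Fin (n k) // ¬ P k (j k) (x k) (y k)} : ℝ) := by
          exact_mod_cast h2
      _ ≤ ∑ _k : ι, ε / (Fintype.card ι + 1) * Fintype.card (∀ k, Fin (n k)) :=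
          Finset.sum_le_sum fun k _ => h1 k
      _ = Fintype.card ι / (Fintype.card ι + 1) * (ε * Fintype.card (∀ k, Fin (n k))) := by
          rw [Finset.sum_const, Finset.card_univ, nsmul_eq_mul]
          ring
      _ < 1 * (ε * Fintype.card (∀ k, Fin (n k))) := by
          refine mul_lt_mul_of_pos_right ?_ (by positivity)
          rw [div_lt_one (by positivity)]
          linarith
      _ = _ := one_mul _

/-- Two increasing families of propositions that agree up to a shift of the index by one differ for
at most one index. -/
theorem card_threshold_differ_le_one {K : ℕ} {p q : ℕ → Prop} (hp : ∀ k l, k ≤ l → p k → p l)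
    (hq : ∀ k l, k ≤ l → q k → q l) (hpq : ∀ k, p k → q (k + 1)) (hqp : ∀ k, q k → p (k + 1)) :
    Nat.card {k : Fin K // ¬ (p k ↔ q k)} ≤ 1 := by
  have key : ∀ k l : ℕ, k < l → ¬ (p k ↔ q k) → (p l ↔ q l) := by
    intro k l hkl hk
    have h1 := hp _ _ hkl.le
    have h2 := hq _ _ hkl.le
    have h3 := fun h => hq _ _ hkl (hpq k h)
    have h4 := fun h => hp _ _ hkl (hqp k h)
    tauto
  rw [Finite.card_le_one_iff_subsingleton]
  refine ⟨fun k l => Subtype.ext (Fin.ext ?_)⟩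
  rcases lt_trichotomy (k.1 : ℕ) l.1 with h | h | h
  · exact absurd (key _ _ h k.2) l.2
  · exact h
  · exact absurd (key _ _ h l.2) k.2

/-- To partition `U ∪ V`, choose a threshold `k < K`; points within distance `k * r` of `U` are moved
to nearby points of `U` and follow a partition of `U`, the others lie in `V` and follow a partition
of `V`. At most one threshold treats two points at distance at most `r` differently. -/
theorem FractionallyHyperfinite.union {X : Type*} [MetricSpace X] {U V : Set X}
    (hU : FractionallyHyperfinite U) (hV : FractionallyHyperfinite V) :
    FractionallyHyperfinite (U ∪ V : Set X) := by
  classical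
  refine FractionallyHyperfinite.of_finite_families fun R ε hε => ?_
  obtain ⟨K, hK⟩ := exists_nat_gt (2 / ε)
  have hK0 : (0 : ℝ) < K := lt_trans (by positivity) hK
  have : Nonempty (Fin K) := ⟨⟨0, by exact_mod_cast hK0⟩⟩
  -- `R` may be nonpositive, while the thresholds need a positive step.
  set r := max R 1
  have hr : 0 < r := by positivity
  -- Close points move by at most `K * r` each, which dictates the scale for the partitions of `U`.
  obtain ⟨m, P, hm, ⟨S, hS⟩, hP⟩ := hU (2 * (K * r) + r) (ε / 2) (by positivity)
  obtain ⟨n, Q, hn, ⟨T, hT⟩, hQ⟩ := hV R (ε / 2) (by positivity)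
  have : Nonempty (Fin m) := ⟨⟨0, hm⟩⟩
  have : Nonempty (Fin n) := ⟨⟨0, hn⟩⟩
  have hm' : (0 : ℝ) < m := by exact_mod_cast hm
  have hn' : (0 : ℝ) < n := by exact_mod_cast hn
  -- `near x k` says that `x` lies within the `k`-th threshold distance of `U`.
  let near : (U ∪ V : Set X) → ℕ → Prop := fun x k => ∃ u : U, dist (x : X) u ≤ k * r
  have hnear_mono : ∀ x k l, k ≤ l → near x k → near x l := by
    rintro x k l hkl ⟨u, hu⟩
    have : (k : ℝ) ≤ l := by exact_mod_cast hkl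
    exact ⟨u, hu.trans (by gcongr)⟩
  have hnear_succ : ∀ x y : (U ∪ V : Set X), dist x y ≤ r → ∀ k, near x k → near y (k + 1) := by
    rintro x y hxy k ⟨u, hu⟩
    refine ⟨u, ?_⟩
    have h1 : dist (x : X) y ≤ r := hxy
    have h2 := dist_triangle_left (y : X) u x
    push_cast
    linarith
  have hfar : ∀ x k, ¬ near x k → (x : X) ∈ V := fun x k h => x.2.resolve_left fun hx =>
    h ⟨⟨x, hx⟩, by rw [dist_self]; positivity⟩
  let label : Fin K × (Fin m × Fin n) → (U ∪ V : Set X) → U ⊕ V := fun a x =>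
    if h : near x a.1 then Sum.inl h.choose else Sum.inr ⟨x, hfar x a.1 h⟩
  have hlabel : ∀ a x, (near x a.1 ∧ ∃ u : U, label a x = Sum.inl u ∧ dist (x : X) u ≤ K * r) ∨
      (¬ near x a.1 ∧ ∃ v : V, label a x = Sum.inr v ∧ (v : X) = x) := by
    intro a x
    by_cases h : near x a.1
    · refine Or.inl ⟨h, h.choose, dif_pos h, h.choose_spec.trans ?_⟩
      have : ((a.1 : ℕ) : ℝ) ≤ K := by exact_mod_cast a.1.2.le
      gcongr
    · exact Or.inr ⟨h, _, dif_neg h, rfl⟩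
  let W : Fin K × (Fin m × Fin n) → Setoid (U ∪ V : Set X) := fun a => Setoid.ker fun x =>
    Sum.map (Quotient.mk (P a.2.1)) (Quotient.mk (Q a.2.2)) (label a x)
  refine ⟨_, inferInstance, inferInstance, W, ⟨2 * (K * r) + |S| + |T|, ?_⟩, fun x y hxy => ?_⟩
  · intro a x y hxy
    have hKr : 0 < K * r := by positivity
    replace hxy := Setoid.ker_def.1 hxy
    rcases hlabel a x with ⟨-, u, hu, hxu⟩ | ⟨-, u, hu, hxu⟩ <;>
      rcases hlabel a y with ⟨-, v, hv, hyv⟩ | ⟨-, v, hv, hyv⟩ <;>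
      rw [hu, hv] at hxy <;> simp only [Sum.map_inl, Sum.map_inr, reduceCtorEq] at hxy
    · have h1 : dist (u : X) v ≤ S := hS _ _ _ (Quotient.exact (Sum.inl_injective hxy))
      have h2 := dist_triangle4_right (x : X) y u v
      have h3 : dist x y = dist (x : X) y := rfl
      linarith [le_abs_self S, abs_nonneg T]
    · have h1 : dist (u : X) v ≤ T := hT _ _ _ (Quotient.exact (Sum.inr_injective hxy))
      have h3 : dist x y = dist (x : X) y := rfl
      rw [hxu, hyv] at h1
      linarith [le_abs_self T, abs_nonneg S]
  · have hxr : dist x y ≤ r := hxy.trans (le_max_left _ _)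
    have hcount := card_threshold_differ_le_one (K := K) (hnear_mono x) (hnear_mono y)
      (hnear_succ x y hxr) (hnear_succ y x (by rwa [dist_comm]))
    have hfiber : ∀ k : Fin K, (Nat.card {b : Fin m × Fin n // ¬ W (k, b) x y} : ℝ) ≤
        m * n * ((if ¬ (near x k ↔ near y k) then 1 else 0) + ε / 2) := by
      intro k
      split_ifs with hk
      swap
      · have h1 : Nat.card {b : Fin m × Fin n // ¬ W (k, b) x y} ≤ m * n := by
          refine (Finite.card_subtype_le _).trans_eq ?_
          simp
        have h2 : (Nat.card {b : Fin m × Fin n // ¬ W (k, b) x y} : ℝ) ≤ m * n := by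
          exact_mod_cast h1
        have : 0 < m * n * (ε / 2) := by positivity
        linarith
      · by_cases hx : near x k
        · have hy := hk.1 hx
          have hd : dist (hx.choose : X) hy.choose ≤ 2 * (K * r) + r := by
            have h1 := hx.choose_spec
            have h2 := hy.choose_spec
            have h3 : (k : ℕ) * r ≤ K * r := by
              have : ((k : ℕ) : ℝ) ≤ K := by exact_mod_cast k.2.le
              gcongr
            have h4 := dist_triangle4 (hx.choose : X) x y hy.choose
            rw [dist_comm (hx.choose : X) x] at h4
            have h5 : dist (x : X) y ≤ r := hxr
            linarith
          have hsub : ∀ b : Fin m × Fin n, ¬ W (k, b) x y →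
              ¬ P b.1 hx.choose hy.choose := by
            intro b hb hPb
            refine hb (Setoid.ker_def.2 ?_)
            have h1 : label (k, b) x = Sum.inl hx.choose := dif_pos hx
            have h2 : label (k, b) y = Sum.inl hy.choose := dif_pos hy
            rw [h1, h2, Sum.map_inl, Sum.map_inl, Quotient.sound hPb]
          have h1 : Nat.card {b : Fin m × Fin n // ¬ W (k, b) x y} ≤
              Nat.card {i // ¬ P i hx.choose hy.choose} * n := by
            refine (Nat.card_le_card_of_injective _
              (Subtype.impEmbedding _ _ hsub).injective).trans_eq ?_
            rw [Nat.card_congr (Equiv.prodSubtypeFstEquivSubtypeProd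
              (p := fun i => ¬ P i hx.choose hy.choose)), Nat.card_prod, Nat.card_fin]
          have h2 := hP _ _ hd
          rw [Fintype.card_fin] at h2
          calc _ ≤ (Nat.card {i // ¬ P i hx.choose hy.choose} : ℝ) * n := by exact_mod_cast h1
            _ ≤ (ε / 2 * m) * n := by gcongr
            _ = _ := by ring
        · have hy := fun h => hx (hk.2 h)
          have hsub : ∀ b : Fin m × Fin n, ¬ W (k, b) x y →
              ¬ Q b.2 ⟨x, hfar x k hx⟩ ⟨y, hfar y k hy⟩ := by
            intro b hb hQb
            refine hb (Setoid.ker_def.2 ?_)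
            have h1 : label (k, b) x = Sum.inr ⟨x, hfar x k hx⟩ := dif_neg hx
            have h2 : label (k, b) y = Sum.inr ⟨y, hfar y k hy⟩ := dif_neg hy
            rw [h1, h2, Sum.map_inr, Sum.map_inr, Quotient.sound hQb]
          have h1 : Nat.card {b : Fin m × Fin n // ¬ W (k, b) x y} ≤
              m * Nat.card {i // ¬ Q i ⟨x, hfar x k hx⟩ ⟨y, hfar y k hy⟩} := by
            refine (Nat.card_le_card_of_injective _
              (Subtype.impEmbedding _ _ hsub).injective).trans_eq ?_
            refine (Nat.card_congr
              (((Equiv.prodComm (Fin m) (Fin n)).subtypeEquiv fun _ => Iff.rfl).trans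
              (Equiv.prodSubtypeFstEquivSubtypeProd
                (p := fun i => ¬ Q i ⟨x, hfar x k hx⟩ ⟨y, hfar y k hy⟩)))).trans ?_
            rw [Nat.card_prod, Nat.card_fin, mul_comm]
          have h2 := hQ ⟨x, hfar x k hx⟩ ⟨y, hfar y k hy⟩ hxy
          rw [Fintype.card_fin] at h2
          calc _ ≤ (m : ℝ) * Nat.card {i // ¬ Q i ⟨x, hfar x k hx⟩ ⟨y, hfar y k hy⟩} := by
                exact_mod_cast h1
            _ ≤ m * (ε / 2 * n) := by gcongr
            _ = _ := by ring
    have hsum : Nat.card {a // ¬ W a x y} =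
        ∑ k : Fin K, Nat.card {b : Fin m × Fin n // ¬ W (k, b) x y} := by
      rw [← Nat.card_sigma]
      exact Nat.card_congr (Equiv.subtypeProdEquivSigmaSubtype fun k b => ¬ W (k, b) x y)
    have hcount' : ∑ k : Fin K, (if ¬ (near x k ↔ near y k) then (1 : ℝ) else 0) ≤ 1 := by
      rw [Finset.sum_boole, ← Fintype.card_subtype, ← Nat.card_eq_fintype_card]
      exact_mod_cast hcount
    have hεK : 1 < K * (ε / 2) := by
      rw [div_lt_iff₀ hε] at hK
      linarith
    calc (Nat.card {a // ¬ W a x y} : ℝ)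
        ≤ ∑ k : Fin K, m * n * ((if ¬ (near x k ↔ near y k) then (1 : ℝ) else 0) + ε / 2) := by
          rw [hsum, Nat.cast_sum]
          exact Finset.sum_le_sum fun k _ => hfiber k
      _ ≤ m * n * (1 + K * (ε / 2)) := by
          rw [← Finset.mul_sum, Finset.sum_add_distrib, Finset.sum_const, Finset.card_univ,
            Fintype.card_fin, nsmul_eq_mul]
          gcongr
      _ < m * n * (K * (ε / 2) + K * (ε / 2)) := by gcongr
      _ = _ := by
          simp only [Fintype.card_prod, Fintype.card_fin, Nat.cast_mul]
          ring

/-! ### Permanence of bounded geometry -/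

theorem BoundedGeometry.subtype {X : Type*} [MetricSpace X] (hX : BoundedGeometry X)
    (U : Set X) : BoundedGeometry U := by
  intro R hR
  obtain ⟨N, hN⟩ := hX R hR
  exact ⟨N, fun x => (Set.encard_le_encard_of_injOn (f := Subtype.val)
    (t := Metric.closedBall (x : X) R) (fun y hy => hy)
    Subtype.val_injective.injOn).trans (hN x)⟩

/-- A subspace of bounded geometry meets balls centred anywhere in the ambient space in uniformly
few points: a ball meeting `U` at `u` is covered by the ball of twice the radius around `u`. -/
theorem BoundedGeometry.exists_encard_le {X : Type*} [MetricSpace X] {U : Set X}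
    (hU : BoundedGeometry U) {R : ℝ} (hR : 0 < R) :
    ∃ N : ℕ, ∀ x : X, (U ∩ Metric.closedBall x R).encard ≤ N := by
  obtain ⟨N, hN⟩ := hU (2 * R) (by positivity)
  refine ⟨N, fun x => ?_⟩
  rcases (U ∩ Metric.closedBall x R).eq_empty_or_nonempty with h | ⟨u, hu, hux⟩
  · simp [h]
  · refine (Set.encard_le_encard ?_).trans
      ((Set.encard_image_le Subtype.val _).trans (hN ⟨u, hu⟩))
    rintro v ⟨hv, hvx⟩
    refine ⟨⟨v, hv⟩, ?_, rfl⟩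
    rw [Metric.mem_closedBall] at *
    have : dist v u ≤ 2 * R := by linarith [dist_triangle_right v u x]
    exact this

theorem BoundedGeometry.union {X : Type*} [MetricSpace X] {U V : Set X}
    (hU : BoundedGeometry U) (hV : BoundedGeometry V) :
    BoundedGeometry (U ∪ V : Set X) := by
  intro R hR
  obtain ⟨M, hM⟩ := hU.exists_encard_le hR
  obtain ⟨N, hN⟩ := hV.exists_encard_le hR
  refine ⟨M + N, fun x => ?_⟩
  refine (Set.encard_le_encard_of_injOn (f := Subtype.val)
    (t := (U ∩ Metric.closedBall (x : X) R) ∪ (V ∩ Metric.closedBall (x : X) R))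
    (fun y hy => ?_) Subtype.val_injective.injOn).trans
    ((Set.encard_union_le _ _).trans ?_)
  · have hy' : (y : X) ∈ Metric.closedBall (x : X) R := hy
    exact y.2.imp (fun h => ⟨h, hy'⟩) fun h => ⟨h, hy'⟩
  · push_cast
    exact add_le_add (hM x) (hN x)

theorem BoundedGeometry.piLp {ι : Type v} [Fintype ι] {X : ι → Type u}
    [∀ i, MetricSpace (X i)] (p : ENNReal) [Fact (1 ≤ p)]
    (hX : ∀ i, BoundedGeometry (X i)) : BoundedGeometry (PiLp p X) := by
  classical
  intro R hR
  choose N hN using fun i => hX i R hR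
  refine ⟨∏ i, N i, fun x => ?_⟩
  have hfin : ∀ i, (Metric.closedBall (x i) R).Finite := fun i =>
    Set.finite_of_encard_le_coe (hN i _)
  have hcard : ∀ i, #(hfin i).toFinset ≤ N i := fun i => by
    have := hN i (x i)
    rw [(hfin i).encard_eq_coe_toFinset_card] at this
    exact_mod_cast this
  refine (Set.encard_le_encard_of_injOn (f := WithLp.ofLp)
    (t := (Fintype.piFinset fun i => (hfin i).toFinset : Set (∀ i, X i))) (fun y hy => ?_)
    (WithLp.ofLp_injective p).injOn).trans ?_
  · rw [Finset.mem_coe, Fintype.mem_piFinset]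
    exact fun i => (hfin i).mem_toFinset.2 ((PiLp.dist_apply_le y x i).trans hy)
  · rw [Set.encard_coe_eq_coe_finsetCard, Fintype.card_piFinset]
    exact_mod_cast Finset.prod_le_prod' fun i _ => hcard i

/-- The two properties are proved together for finite unions, since the induction only needs the
case of two subspaces for each of them. -/
theorem BoundedGeometry.and_fractionallyHyperfinite_biUnion {X : Type*} [MetricSpace X]
    {ι : Type*} {U : ι → Set X} (hU : ∀ i, BoundedGeometry (U i))
    (hF : ∀ i, FractionallyHyperfinite (U i)) (s : Finset ι) :
    BoundedGeometry (⋃ i ∈ s, U i : Set X) ∧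
      FractionallyHyperfinite (⋃ i ∈ s, U i : Set X) := by
  classical
  induction s using Finset.induction_on with
  | empty =>
    have : IsEmpty (⋃ i ∈ (∅ : Finset ι), U i : Set X) := by simp
    exact ⟨fun R _ => ⟨0, fun x => isEmptyElim x⟩, fun R ε hε =>
      ⟨1, fun _ => ⊤, one_pos, ⟨0, fun _ x => isEmptyElim x⟩, fun x => isEmptyElim x⟩⟩
  | insert i s _ ih =>
    rw [Finset.set_biUnion_insert]
    exact ⟨(hU i).union ih.1, (hF i).union ih.2⟩

/-! ### Permanence of naive property A -/

theorem NaivePropertyA.of_coarselyEquivalent {X : Type*} {Y : Type*} [MetricSpace X]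
    [MetricSpace Y] (hA : NaivePropertyA Y) (hX : BoundedGeometry X) (hY : BoundedGeometry Y)
    (h : CoarselyEquivalent X Y) : NaivePropertyA X := by
  obtain ⟨f, g, hf, hg, ⟨C, hC⟩, -⟩ := h
  refine ((hA.fractionallyHyperfinite hY).comap hf fun S => ?_).naivePropertyA hX
  obtain ⟨T, hT⟩ := hg S
  refine ⟨T + 2 * C, fun x x' hxx' => ?_⟩
  have h1 : dist (g (f x)) x ≤ C := hC x
  have h2 : dist (g (f x')) x' ≤ C := hC x'
  rw [dist_comm] at h1
  linarith [hT _ _ hxx', dist_triangle4 x (g (f x)) (g (f x')) x']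

theorem CoarselyEquivalent.symm {X : Type*} {Y : Type*} [MetricSpace X] [MetricSpace Y]
    (h : CoarselyEquivalent X Y) : CoarselyEquivalent Y X := by
  obtain ⟨f, g, hf, hg, hgf, hfg⟩ := h
  exact ⟨g, f, hg, hf, hfg, hgf⟩

theorem mainTheorem2 :
    -- subspaces
    (∀ (X : Type u) [MetricSpace X], BoundedGeometry X → NaivePropertyA X →
      ∀ U : Set X, NaivePropertyA U) ∧
    -- finite unions
    (∀ (X : Type u) [MetricSpace X] (ι : Type v) [Finite ι] (U : ι → Set X),
      (∀ i, BoundedGeometry (U i)) → (∀ i, NaivePropertyA (U i)) →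
      NaivePropertyA (⋃ i, U i : Set X)) ∧
    -- finite Cartesian products, with any of the `p`-product metrics (`p = ∞`: the sup metric)
    (∀ (ι : Type v) [Fintype ι] (X : ι → Type u) [∀ i, MetricSpace (X i)]
      (p : ENNReal) [Fact (1 ≤ p)],
      (∀ i, BoundedGeometry (X i)) → (∀ i, NaivePropertyA (X i)) →
      NaivePropertyA (PiLp p X)) ∧
    -- coarse equivalences
    (∀ (X : Type u) (Y : Type w) [MetricSpace X] [MetricSpace Y],
      BoundedGeometry X → BoundedGeometry Y → CoarselyEquivalent X Y →
      (NaivePropertyA X ↔ NaivePropertyA Y)) := by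
  refine ⟨fun X _ hX hA U => ?_, fun X _ ι _ U hU hA => ?_, fun ι _ X _ p _ hX hA => ?_,
    fun X Y _ _ hX hY h => ⟨fun hA => hA.of_coarselyEquivalent hY hX h.symm,
      fun hA => hA.of_coarselyEquivalent hX hY h⟩⟩
  · exact ((hA.fractionallyHyperfinite hX).comap (f := ((↑) : U → X)) (fun R => ⟨R, fun _ _ => id⟩)
      fun S => ⟨S, fun _ _ => id⟩).naivePropertyA (hX.subtype U)
  · have := Fintype.ofFinite ι
    have h := BoundedGeometry.and_fractionallyHyperfinite_biUnion hU
      (fun i => (hA i).fractionallyHyperfinite (hU i)) Finset.univ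
    have hs : ⋃ i ∈ Finset.univ, U i = ⋃ i, U i := by simp
    rw [hs] at h
    exact h.2.naivePropertyA h.1
  · exact (FractionallyHyperfinite.piLp p fun i =>
      (hA i).fractionallyHyperfinite (hX i)).naivePropertyA (BoundedGeometry.piLp p hX)
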